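/- Let $R$ be a commutative noetherian ring; all modules are finitely generated. Let $C$ be a semidualizing $R$-module, i.e. the homothety map $R\to\mathrm{Hom}_R(C,C)$ is an isomorphism and $\mathrm{Ext}^{i}_R(C,C)=0$ for all $i>0$; write $(-)^{\dagger}=\mathrm{Hom}_R(-,C)$. The depth of a module over a local ring is the supremum of the lengths of regular sequences in the maximal ideal, with $\operatorname{depth} 0=\infty$. Put $d=\sup\{\operatorname{depth} R_{\mathfrak p}\mid \mathfrak p\in\operatorname{Spec}R\}$ and assume $0<d<\infty$. Assume moreover that - $R$ satisfies $(S_d)$: $\operatorname{depth} R_{\mathfrak p}\ge\min\{d,\dim R_{\mathfrak p}\}$ for every prime $\mathfrak p$; - $R$ satisfies $(G_0^C)$: for every prime $\mathfrak p$ of height $0$, the $R_{\mathfrak p}$-module $C_{\mathfrak p}$ has finite injective dimension; - $R$ satisfies $(ES_1^C)$: every $R$-module $X$ with $\mathrm{Ext}^{i}_R(X,C)=0$ for all $i>0$ satisfies $\operatorname{depth} X_{\mathfrak p}\ge\min\{1,\operatorname{depth} R_{\mathfrak p}\}$ for every prime $\mathfrak p$. Then every $R$-module $M$ with $\mathrm{Ext}^{i}_R(M,C)=0$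 for all $i>0$ is totally $C$-reflexive, that is, the natural map $M\to M^{\dagger\dagger}$ is an isomorphism and $\mathrm{Ext}^{i}_R(M,C)=0=\mathrm{Ext}^{i}_R(M^{\dagger},C)$ for all $i>0$. -/

import Mathlib

open CategoryTheory

universe u

/-- `Ext^i_R(M, N) = 0` for all `i > 0`. -/
def ExtPosVanish (R : Type u) [CommRing R] (M N : Type u) [AddCommGroup M] [Module R M]
    [AddCommGroup N] [Module R N] : Prop :=
  ∀ i : ℕ, 0 < i → Subsingleton (Abelian.Ext (ModuleCat.of R M) (ModuleCat.of R N) i)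

/-- `C` is semidualizing: it is finitely generated, the homothety map `R → Hom_R(C, C)` is an
isomorphism, and `Ext^i_R(C, C) = 0` for all `i > 0`. -/
structure IsSemidualizing (R : Type u) [CommRing R] (C : Type u) [AddCommGroup C]
    [Module R C] : Prop where
  finite : Module.Finite R C
  homothety : Function.Bijective (LinearMap.lsmul R C : R →ₗ[R] C →ₗ[R] C)
  ext_self : ExtPosVanish R C C

/-- The natural map `M → Hom_R(Hom_R(M, C), C)`, `m ↦ (f ↦ f m)`. -/
def bidualMap (R : Type u) [CommRing R] (C M : Type u) [AddCommGroup C] [Module R C]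
    [AddCommGroup M] [Module R M] : M →ₗ[R] (M →ₗ[R] C) →ₗ[R] C :=
  (LinearMap.id : (M →ₗ[R] C) →ₗ[R] (M →ₗ[R] C)).flip

/-- `M` is totally `C`-reflexive. -/
structure IsTotallyReflexive (R : Type u) [CommRing R] (C M : Type u) [AddCommGroup C]
    [Module R C] [AddCommGroup M] [Module R M] : Prop where
  bijective : Function.Bijective (bidualMap R C M)
  ext_left : ExtPosVanish R M C
  ext_dual : ExtPosVanish R (M →ₗ[R] C) C

/-- The depth of a finitely generated module over a noetherian local ring: the supremum of the
lengths of `M`-regular sequences in the maximal ideal. For `M ≠ 0` the condition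
`M ≠ (x₁, …, xₙ)M` is automatic by Nakayama's lemma, so it is not imposed; thus the
zero module has depth `∞`, as usual. -/
noncomputable def moduleDepth (A : Type u) [CommRing A] [IsLocalRing A] (M : Type u)
    [AddCommGroup M] [Module A M] : ℕ∞ :=
  ⨆ rs : {rs : List A // (∀ r ∈ rs, r ∈ IsLocalRing.maximalIdeal A) ∧
    RingTheory.Sequence.IsWeaklyRegular M rs}, (rs.1.length : ℕ∞)

/-- The depth of the local ring `R_𝔭`. -/
noncomputable def ringDepthAt (R : Type u) [CommRing R] (p : PrimeSpectrum R) : ℕ∞ :=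
  moduleDepth (Localization.AtPrime p.asIdeal) (Localization.AtPrime p.asIdeal)

/-- The depth of the `R_𝔭`-module `M_𝔭`. -/
noncomputable def depthAt (R : Type u) [CommRing R] (M : Type u) [AddCommGroup M] [Module R M]
    (p : PrimeSpectrum R) : ℕ∞ :=
  moduleDepth (Localization.AtPrime p.asIdeal) (LocalizedModule p.asIdeal.primeCompl M)

/-- Serre's condition `(S_n)`: `depth M_𝔭 ≥ min {n, dim R_𝔭}` for every prime `𝔭`. -/
def SerreS (R : Type u) [CommRing R] (M : Type u) [AddCommGroup M] [Module R M] (n : ℕ) : Prop :=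
  ∀ p : PrimeSpectrum R,
    min (n : WithBot ℕ∞) (ringKrullDim (Localization.AtPrime p.asIdeal)) ≤
      ((depthAt R M p : ℕ∞) : WithBot ℕ∞)

/-- The condition `(S̃_n)`: `depth M_𝔭 ≥ min {n, depth R_𝔭}` for every prime `𝔭`. -/
def SerreSTilde (R : Type u) [CommRing R] (M : Type u) [AddCommGroup M] [Module R M]
    (n : ℕ) : Prop :=
  ∀ p : PrimeSpectrum R, min (n : ℕ∞) (ringDepthAt R p) ≤ depthAt R M p

/-- The condition `(ES_n^C)`: every finitely generated module `X` with `Ext^{>0}_R(X, C) = 0`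
satisfies `(S̃_n)`. -/
def ConditionES (R : Type u) [CommRing R] (C : Type u) [AddCommGroup C] [Module R C]
    (n : ℕ) : Prop :=
  ∀ (X : Type u) [AddCommGroup X] [Module R X] [Module.Finite R X],
    ExtPosVanish R X C → SerreSTilde R X n

/-- The condition `(G_n^C)`: `C_𝔭` has finite injective dimension over `R_𝔭` for every prime `𝔭`
of height at most `n`. -/
def ConditionG (R : Type u) [CommRing R] (C : Type u) [AddCommGroup C] [Module R C]
    (n : ℕ) : Prop :=
  ∀ p : PrimeSpectrum R, p.asIdeal.height ≤ (n : ℕ∞) →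
    ∃ k : ℕ, HasInjectiveDimensionLE
      (ModuleCat.of (Localization.AtPrime p.asIdeal) (LocalizedModule p.asIdeal.primeCompl C)) k

/-! ### Long exact `Ext` sequences in the first variable -/

section ExtVanishing

open Abelian

variable {R : Type u} [CommRing R] {A B Y : Type u} [AddCommGroup A] [Module R A]
  [AddCommGroup B] [Module R B] [AddCommGroup Y] [Module R Y]
  {f : A →ₗ[R] B} {g : B →ₗ[R] Y}

/-! Call `X` good if `Ext^{>0}(X, C) = 0`. The local hypotheses serve only to show that good modules
are `C`-torsionless (`bidualMap_injective`): an associated prime of the kernel of `X → X††` has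
depth zero, hence height zero, and there `C` is injective enough to detect socle elements. The rest
is formal. Generators of `X†` embed a good `X` in some `Cⁿ` with surjective dual, and the cokernel
`Y` is again good (`exists_pi_embedding`). Torsionlessness of both `X` and `Y` makes `X` reflexive.
Dualizing gives `0 → Y† → Rⁿ → X† → 0`; reflexivity of `Y` kills `Ext¹(X†, C)`, and higher `Ext`
shifts from `X†` to `Y†`. -/

lemma shortExact_of_linearMap (hf : Function.Injective f) (hg : Function.Surjective g)
    (hfg : Function.Exact f g) :
    (ModuleCat.shortComplexOfCompEqZero f g hfg.linearMap_comp_eq_zero).ShortExact :=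
  ModuleCat.shortComplex_shortExact _ hfg hf hg

variable (C : Type u) [AddCommGroup C] [Module R C]

lemma subsingleton_ext_quotient (hf : Function.Injective f) (hg : Function.Surjective g)
    (hfg : Function.Exact f g) {i : ℕ}
    (hB : Subsingleton (Ext (ModuleCat.of R B) (ModuleCat.of R C) (i + 1)))
    (hA : Subsingleton (Ext (ModuleCat.of R A) (ModuleCat.of R C) i)) :
    Subsingleton (Ext (ModuleCat.of R Y) (ModuleCat.of R C) (i + 1)) := by
  refine subsingleton_of_forall_eq 0 fun e ↦ ?_
  obtain ⟨x, rfl⟩ := Ext.contravariant_sequence_exact₃ (shortExact_of_linearMap hf hg hfg)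
    (ModuleCat.of R C) e (Subsingleton.elim _ _) (add_comm 1 i)
  rw [show x = 0 from Subsingleton.elim _ _, Ext.comp_zero]

/-- Each class is the connecting image of some `A → C`, and the connecting map kills maps that
extend to `B`. -/
lemma subsingleton_ext_one_quotient (hf : Function.Injective f) (hg : Function.Surjective g)
    (hfg : Function.Exact f g)
    (hB : Subsingleton (Ext (ModuleCat.of R B) (ModuleCat.of R C) 1))
    (hA : ∀ φ : A →ₗ[R] C, ∃ ψ : B →ₗ[R] C, ψ ∘ₗ f = φ) :
    Subsingleton (Ext (ModuleCat.of R Y) (ModuleCat.of R C) 1) := by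
  refine subsingleton_of_forall_eq 0 fun e ↦ ?_
  have hS := shortExact_of_linearMap hf hg hfg
  obtain ⟨x, rfl⟩ := Ext.contravariant_sequence_exact₃ hS
    (ModuleCat.of R C) e (Subsingleton.elim _ _) (add_comm 1 0)
  obtain ⟨φ, rfl⟩ := (Ext.mk₀_bijective _ _).2 x
  obtain ⟨ψ, hψ⟩ := hA φ.hom
  have h : φ = ModuleCat.ofHom f ≫ ModuleCat.ofHom ψ := by
    ext1
    simp [← hψ]
  rw [h, ← Ext.mk₀_comp_mk₀, ← Ext.comp_assoc _ _ _ (add_comm 1 0) (add_zero 0) (by simp)]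
  erw [hS.extClass_comp]
  rw [Ext.zero_comp]

lemma subsingleton_ext_sub (hf : Function.Injective f) (hg : Function.Surjective g)
    (hfg : Function.Exact f g) {i : ℕ}
    (hB : Subsingleton (Ext (ModuleCat.of R B) (ModuleCat.of R C) i))
    (hY : Subsingleton (Ext (ModuleCat.of R Y) (ModuleCat.of R C) (i + 1))) :
    Subsingleton (Ext (ModuleCat.of R A) (ModuleCat.of R C) i) := by
  refine subsingleton_of_forall_eq 0 fun e ↦ ?_
  obtain ⟨x, rfl⟩ := Ext.contravariant_sequence_exact₁ (shortExact_of_linearMap hf hg hfg)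
    (ModuleCat.of R C) e (add_comm 1 i) (Subsingleton.elim _ _)
  rw [show x = 0 from Subsingleton.elim _ _, Ext.comp_zero]

lemma subsingleton_ext_middle (hf : Function.Injective f) (hg : Function.Surjective g)
    (hfg : Function.Exact f g) {i : ℕ}
    (hA : Subsingleton (Ext (ModuleCat.of R A) (ModuleCat.of R C) i))
    (hY : Subsingleton (Ext (ModuleCat.of R Y) (ModuleCat.of R C) i)) :
    Subsingleton (Ext (ModuleCat.of R B) (ModuleCat.of R C) i) := by
  refine subsingleton_of_forall_eq 0 fun e ↦ ?_
  obtain ⟨x, rfl⟩ := Ext.contravariant_sequence_exact₂ (shortExact_of_linearMap hf hg hfg)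
    (ModuleCat.of R C) e (Subsingleton.elim _ _)
  rw [show x = 0 from Subsingleton.elim _ _, Ext.comp_zero]

lemma exists_extension_of_subsingleton_ext_one (hf : Function.Injective f)
    (hg : Function.Surjective g) (hfg : Function.Exact f g)
    (hY : Subsingleton (Ext (ModuleCat.of R Y) (ModuleCat.of R C) 1)) (φ : A →ₗ[R] C) :
    ∃ ψ : B →ₗ[R] C, ψ ∘ₗ f = φ := by
  obtain ⟨x, hx⟩ := Ext.contravariant_sequence_exact₁ (shortExact_of_linearMap hf hg hfg)
    (ModuleCat.of R C) (Ext.mk₀ (ModuleCat.ofHom φ)) (add_comm 1 0) (Subsingleton.elim _ _)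
  obtain ⟨ψ, rfl⟩ := (Ext.mk₀_bijective _ _).2 x
  rw [Ext.mk₀_comp_mk₀] at hx
  have := (Ext.mk₀_bijective _ _).1 hx
  exact ⟨ψ.hom, congr(ModuleCat.Hom.hom $this)⟩

lemma subsingleton_ext_of_subsingleton (A : Type u) [AddCommGroup A] [Module R A] [Subsingleton A]
    (i : ℕ) : Subsingleton (Ext (ModuleCat.of R A) (ModuleCat.of R C) i) := by
  refine subsingleton_of_forall_eq 0 fun e ↦ ?_
  have h : 𝟙 (ModuleCat.of R A) = 0 := (ModuleCat.isZero_of_subsingleton _).eq_of_src _ _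
  rw [← Ext.mk₀_id_comp e, h, Ext.mk₀_zero, Ext.zero_comp]

lemma subsingleton_ext_of_linearEquiv (e : A ≃ₗ[R] B) {i : ℕ}
    (h : Subsingleton (Ext (ModuleCat.of R A) (ModuleCat.of R C) i)) :
    Subsingleton (Ext (ModuleCat.of R B) (ModuleCat.of R C) i) :=
  subsingleton_ext_middle C (f := e.toLinearMap) (g := (0 : B →ₗ[R] PUnit.{u + 1})) e.injective
    (Function.surjective_to_subsingleton _)
    ((e.toLinearMap.exact_zero_iff_surjective _).2 e.surjective) h
    (subsingleton_ext_of_subsingleton C _ i)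

lemma subsingleton_ext_of_projective (P : Type u) [AddCommGroup P] [Module R P]
    [Module.Projective R P] (i : ℕ) :
    Subsingleton (Ext (ModuleCat.of R P) (ModuleCat.of R C) (i + 1)) :=
  have := (IsProjective.iff_projective P).1 ‹Module.Projective R P›
  Ext.subsingleton_of_projective _ _ i

variable {C}

lemma ExtPosVanish.pi {B : Type u} [AddCommGroup B] [Module R B] (h : ExtPosVanish R B C) (n : ℕ) :
    ExtPosVanish R (Fin n → B) C := by
  intro i hi
  induction n with
  | zero => exact subsingleton_ext_of_subsingleton C _ i
  | succ n ih =>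
    refine subsingleton_ext_of_linearEquiv C (Fin.consLinearEquiv R fun _ : Fin (n + 1) ↦ B) ?_
    exact subsingleton_ext_middle C (f := LinearMap.inl R B (Fin n → B)) (g := LinearMap.snd R _ _)
      LinearMap.inl_injective Prod.snd_surjective Function.Exact.inl_snd (h i hi) ih

end ExtVanishing

/-! ### Finite injective dimension over artinian local rings -/

section ArtinianLocal

open Abelian IsLocalRing

variable {A : Type u} [CommRing A] [IsLocalRing A]

/-- A nonzero element killed by the maximal ideal spans a copy of the residue field. -/
lemma exists_injective_of_maximalIdeal_smul_eq_zero {N : Type u} [AddCommGroup N] [Module A N]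
    {z : N} (hz : z ≠ 0) (h : ∀ r ∈ maximalIdeal A, r • z = 0) :
    ∃ j : (A ⧸ maximalIdeal A) →ₗ[A] N, Function.Injective j ∧ j (Submodule.Quotient.mk 1) = z := by
  have hle : maximalIdeal A ≤ LinearMap.ker (LinearMap.toSpanSingleton A N z) := fun r hr ↦ by
    simpa using h r hr
  have heq : LinearMap.ker (LinearMap.toSpanSingleton A N z) = maximalIdeal A :=
    ((maximalIdeal.isMaximal A).eq_of_le (fun htop ↦ hz (by
      have : (1 : A) ∈ LinearMap.ker (LinearMap.toSpanSingleton A N z) := htop ▸ trivial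
      simpa using this)) hle).symm
  exact ⟨Submodule.liftQ _ _ hle, LinearMap.ker_eq_bot.1 (Submodule.ker_liftQ_eq_bot _ _ _ heq.le),
    one_smul A z⟩

variable [IsArtinianRing A]

lemma exists_ne_zero_maximalIdeal_smul_eq_zero (N : Type u) [AddCommGroup N] [Module A N]
    [Nontrivial N] : ∃ z : N, z ≠ 0 ∧ ∀ r ∈ maximalIdeal A, r • z = 0 := by
  obtain ⟨p, hp⟩ := associatedPrimes.nonempty A N
  rw [AssociatedPrimes.mem_iff, isAssociatedPrime_iff] at hp
  obtain ⟨hp, z, hz⟩ := hp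
  have := eq_maximalIdeal (I := p) inferInstance
  refine ⟨z, ?_, fun r hr ↦ ?_⟩
  · rintro rfl
    exact hp.ne_top (by rw [hz]; ext; simp [Submodule.mem_colon_singleton])
  · rw [← this, hz] at hr
    simpa [Submodule.mem_colon_singleton] using hr

variable {C : Type u} [AddCommGroup C] [Module A C]

/-- The residue field embeds in `A` as part of the socle, so its `Ext` in degree `n + 1` sits
between that of the free module `A` and degree `n + 2` of the cokernel. Prime filtrations give all
finite modules, as the only prime is maximal. -/
lemma subsingleton_ext_of_subsingleton_ext_succ {n : ℕ}
    (h : ∀ (N : Type u) [AddCommGroup N] [Module A N] [Module.Finite A N],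
      Subsingleton (Ext (ModuleCat.of A N) (ModuleCat.of A C) (n + 2)))
    (N : Type u) [AddCommGroup N] [Module A N] [Module.Finite A N] :
    Subsingleton (Ext (ModuleCat.of A N) (ModuleCat.of A C) (n + 1)) := by
  have hk : Subsingleton (Ext (ModuleCat.of A (A ⧸ maximalIdeal A)) (ModuleCat.of A C) (n + 1)) := by
    obtain ⟨z, hz, hz'⟩ := exists_ne_zero_maximalIdeal_smul_eq_zero (A := A) A
    obtain ⟨j, hj, -⟩ := exists_injective_of_maximalIdeal_smul_eq_zero hz hz'
    exact subsingleton_ext_sub C hj (Submodule.mkQ_surjective _) (LinearMap.exact_map_mkQ_range j)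
      (subsingleton_ext_of_projective C A n) (h _)
  induction ‹Module.Finite A N› using IsNoetherianRing.induction_on_isQuotientEquivQuotientPrime A with
  | subsingleton N => exact subsingleton_ext_of_subsingleton C N _
  | quotient N p e =>
    have : p.asIdeal = maximalIdeal A := eq_maximalIdeal inferInstance
    exact subsingleton_ext_of_linearEquiv C
      ((Submodule.quotEquivOfEq _ _ this.symm).trans e.symm) hk
  | exact N₁ N₂ N₃ f g hf hg hfg h₁ h₃ => exact subsingleton_ext_middle C hf hg hfg h₁ h₃

lemma subsingleton_ext_one_of_hasInjectiveDimensionLE {k : ℕ}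
    (hk : HasInjectiveDimensionLE (ModuleCat.of A C) k)
    (N : Type u) [AddCommGroup N] [Module A N] [Module.Finite A N] :
    Subsingleton (Ext (ModuleCat.of A N) (ModuleCat.of A C) 1) := by
  suffices H : ∀ n ≤ k, ∀ (N : Type u) [AddCommGroup N] [Module A N] [Module.Finite A N],
      Subsingleton (Ext (ModuleCat.of A N) (ModuleCat.of A C) (n + 1)) from H 0 k.zero_le N
  intro n hn
  induction hn using Nat.decreasingInduction with
  | self => intro N _ _ _; exact HasInjectiveDimensionLT.subsingleton _ (k + 1) _ le_rfl _
  | of_succ n hn ih => exact fun N _ _ _ ↦ subsingleton_ext_of_subsingleton_ext_succ ih N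

lemma exists_linearMap_apply_ne_zero [Nontrivial C] {k : ℕ}
    (hk : HasInjectiveDimensionLE (ModuleCat.of A C) k)
    {N : Type u} [AddCommGroup N] [Module A N] [Module.Finite A N]
    {z : N} (hz : z ≠ 0) (h : ∀ r ∈ maximalIdeal A, r • z = 0) :
    ∃ φ : N →ₗ[A] C, φ z ≠ 0 := by
  obtain ⟨c, hc, hc'⟩ := exists_ne_zero_maximalIdeal_smul_eq_zero (A := A) C
  obtain ⟨j, hj, hjz⟩ := exists_injective_of_maximalIdeal_smul_eq_zero hz h
  -- Send the residue field spanned by `z` onto a socle line of `C`, then extend to `N` using `Ext¹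
  -- = 0`.
  obtain ⟨l, -, hlc⟩ := exists_injective_of_maximalIdeal_smul_eq_zero hc hc'
  obtain ⟨φ, hφ⟩ := exists_extension_of_subsingleton_ext_one C hj (Submodule.mkQ_surjective _)
    (LinearMap.exact_map_mkQ_range j) (subsingleton_ext_one_of_hasInjectiveDimensionLE hk _) l
  refine ⟨φ, ?_⟩
  rwa [← hjz, ← LinearMap.comp_apply, hφ, hlc]

end ArtinianLocal

/-! ### Depth zero from a socle element -/

section Depth

open IsLocalRing

lemma moduleDepth_eq_zero {A : Type u} [CommRing A] [IsLocalRing A] {N : Type u} [AddCommGroup N]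
    [Module A N] {z : N} (hz : z ≠ 0) (h : ∀ r ∈ maximalIdeal A, r • z = 0) :
    moduleDepth A N = 0 := by
  refine le_antisymm (iSup_le ?_) bot_le
  rintro ⟨_ | ⟨r, rs⟩, hm, hreg⟩
  · simp
  · have hr := ((RingTheory.Sequence.isWeaklyRegular_cons_iff N r rs).1 hreg).1
    -- The first entry of a regular sequence acts injectively, yet kills `z`.
    exact absurd (hr (by simp [h r (hm r (by simp))] : r • z = r • 0)) hz

lemma moduleDepth_congr {A : Type u} [CommRing A] [IsLocalRing A] {N N' : Type u} [AddCommGroup N]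
    [Module A N] [AddCommGroup N'] [Module A N'] (e : N ≃ₗ[A] N') :
    moduleDepth A N = moduleDepth A N' := by
  simp_rw [moduleDepth, iSup_subtype, e.isWeaklyRegular_congr]

variable (R : Type u) [CommRing R]

lemma depthAt_self (p : PrimeSpectrum R) : depthAt R R p = ringDepthAt R p :=
  moduleDepth_congr
    (IsLocalizedModule.linearEquiv p.asIdeal.primeCompl
      (LocalizedModule.mkLinearMap p.asIdeal.primeCompl R)
      (Algebra.linearMap R (Localization.AtPrime p.asIdeal))
      |>.extendScalarsOfIsLocalization p.asIdeal.primeCompl _)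

end Depth

/-! ### Good modules are torsionless -/

section Reflexive

open IsLocalRing

variable {R : Type u} [CommRing R] {C : Type u} [AddCommGroup C] [Module R C]

lemma exists_ne_zero_smul_eq_zero_of_eq_annihilator {X : Type u}
    [AddCommGroup X] [Module R X] (p : PrimeSpectrum R) {x : X}
    (hx : ∀ r : R, r ∈ p.asIdeal ↔ r • x = 0) :
    LocalizedModule.mkLinearMap p.asIdeal.primeCompl X x ≠ 0 ∧
      ∀ r ∈ maximalIdeal (Localization.AtPrime p.asIdeal),
        r • LocalizedModule.mkLinearMap p.asIdeal.primeCompl X x = 0 := by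
  constructor
  · intro h
    rw [IsLocalizedModule.eq_zero_iff p.asIdeal.primeCompl] at h
    obtain ⟨s, hs⟩ := h
    exact s.2 ((hx _).2 hs)
  · intro r hr
    obtain ⟨a, s, rfl⟩ := IsLocalization.exists_mk'_eq p.asIdeal.primeCompl r
    rw [IsLocalization.AtPrime.mk'_mem_maximal_iff _ p.asIdeal] at hr
    have ha : a • x = 0 := (hx a).1 hr
    rw [IsLocalization.mk'_eq_mul_mk'_one, mul_comm, mul_smul, algebraMap_smul, ← map_smul, ha,
      map_zero, smul_zero]

lemma dual_mkQ_injective {X B : Type u} [AddCommGroup X] [Module R X] [AddCommGroup B]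
    [Module R B] (f : X →ₗ[R] B) :
    Function.Injective (LinearMap.lcomp R C (LinearMap.range f).mkQ) :=
  fun _ _ h ↦ LinearMap.cancel_right (Submodule.mkQ_surjective _) |>.1 h

lemma dual_mkQ_exact {X B : Type u} [AddCommGroup X] [Module R X] [AddCommGroup B]
    [Module R B] (f : X →ₗ[R] B) :
    Function.Exact (LinearMap.lcomp R C (LinearMap.range f).mkQ) (LinearMap.lcomp R C f) := by
  intro ψ
  constructor
  · intro h
    exact ⟨(LinearMap.range f).liftQ ψ (LinearMap.range_le_ker_iff.2 h), by ext; simp⟩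
  · rintro ⟨y, rfl⟩
    ext x
    simp [(Submodule.Quotient.mk_eq_zero _).2 (LinearMap.mem_range_self f x)]

lemma nontrivial_localizedModule [IsNoetherianRing R] (hC : IsSemidualizing R C)
    (p : PrimeSpectrum R) : Nontrivial (LocalizedModule p.asIdeal.primeCompl C) := by
  have := hC.finite
  rw [← Module.mem_support_iff, Module.support_eq_zeroLocus]
  have : Module.annihilator R C = ⊥ := by
    rw [eq_bot_iff]
    intro r hr
    refine hC.homothety.1 ?_
    ext c
    simpa using Module.mem_annihilator.1 hr c
  simp [this]

/-- As `Hom(C, C) = R`, every map `Cⁿ → C` is an `R`-combination of projections, so `φ` is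
evaluation at the vector of its values on them. -/
lemma bidualMap_pi_surjective (hC : IsSemidualizing R C) (n : ℕ) :
    Function.Surjective (bidualMap R C (Fin n → C)) := by
  intro φ
  have h (i : Fin n) : ∃ c : C, ∀ h : C →ₗ[R] C, φ (h ∘ₗ LinearMap.proj i) = h c := by
    refine ⟨φ (LinearMap.proj i), fun h ↦ ?_⟩
    obtain ⟨r, rfl⟩ := hC.homothety.2 h
    rw [show LinearMap.lsmul R C r ∘ₗ LinearMap.proj i
      = r • (LinearMap.proj i : (Fin n → C) →ₗ[R] C) from rfl, map_smul]
    rfl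
  choose c hc using h
  refine ⟨c, ?_⟩
  ext ψ
  have hψ : ψ = ∑ i, (ψ ∘ₗ LinearMap.single R (fun _ : Fin n ↦ C) i) ∘ₗ LinearMap.proj i := by
    ext i x
    simp only [LinearMap.comp_apply, LinearMap.sum_apply, LinearMap.proj_apply]
    rw [Finset.sum_eq_single i (fun j _ hj ↦ by simp [Pi.single_eq_of_ne hj]) (by simp)]
    simp
  rw [hψ, map_sum, map_sum]
  refine Finset.sum_congr rfl fun i _ ↦ ?_
  rw [hc]
  rfl

lemma projective_dual_pi (hC : IsSemidualizing R C) (n : ℕ) :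
    Module.Projective R ((Fin n → C) →ₗ[R] C) :=
  Module.Projective.of_equiv ((LinearEquiv.piCongrRight fun _ : Fin n ↦
    LinearEquiv.ofBijective _ hC.homothety).trans (LinearMap.lsum R (fun _ : Fin n ↦ C) R))

variable [IsNoetherianRing R]

theorem bidualMap_injective (hC : IsSemidualizing R C) {d : ℕ} (hd : 0 < d) (hS : SerreS R R d)
    (hG : ConditionG R C 0) (hES : ConditionES R C 1)
    {X : Type u} [AddCommGroup X] [Module R X] [Module.Finite R X] (hX : ExtPosVanish R X C) :
    Function.Injective (bidualMap R C X) := by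
  rw [← LinearMap.ker_eq_bot, ← Submodule.subsingleton_iff_eq_bot]
  by_contra hne
  rw [not_subsingleton_iff_nontrivial] at hne
  obtain ⟨q, hq⟩ := associatedPrimes.nonempty R (LinearMap.ker (bidualMap R C X))
  rw [AssociatedPrimes.mem_iff, isAssociatedPrime_iff] at hq
  obtain ⟨hqp, ⟨x, hxker⟩, hx⟩ := hq
  let p : PrimeSpectrum R := ⟨q, hqp⟩
  have hxp (r : R) : r ∈ p.asIdeal ↔ r • x = 0 := by
    change r ∈ q ↔ _
    rw [hx]
    simp [Submodule.mem_colon_singleton]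
  obtain ⟨hz, hz'⟩ := exists_ne_zero_smul_eq_zero_of_eq_annihilator p hxp
  have hdepth : ringDepthAt R p = 0 := by
    have h := hES X hX p
    rw [depthAt, moduleDepth_eq_zero hz hz'] at h
    simpa using h
  have hdim : ringKrullDim (Localization.AtPrime p.asIdeal) = 0 := by
    have h := hS p
    rw [depthAt_self, hdepth] at h
    refine le_antisymm ?_ ringKrullDim_nonneg_of_nontrivial
    -- Here `min {d, dim} ≤ 0`, and `d > 0` leaves only dimension zero.
    rcases min_le_iff.1 h with h | h
    · exact absurd (by exact_mod_cast h) hd.not_ge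
    · exact h
  obtain ⟨k, hk⟩ := hG p (by
    rw [IsLocalization.AtPrime.ringKrullDim_eq_height p.asIdeal] at hdim
    exact_mod_cast hdim.le)
  have : IsArtinianRing (Localization.AtPrime p.asIdeal) := by
    rw [isArtinianRing_iff_krullDimLE_zero, Ring.KrullDimLE, Order.krullDimLE_iff]
    exact hdim.le
  have := nontrivial_localizedModule hC p
  have := hC.finite
  obtain ⟨φ, hφ⟩ := exists_linearMap_apply_ne_zero hk hz hz'
  have : Module.FinitePresentation R X := Module.finitePresentation_of_finite R X
  -- `X` is finitely presented, so `Hom` localizes: `s • φ` comes from some `f : X → C`, which kills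
  -- `x` because `x` lies in the kernel of biduality.
  obtain ⟨⟨f, s⟩, hf⟩ := IsLocalizedModule.surj p.asIdeal.primeCompl
    (LocalizedModule.map p.asIdeal.primeCompl (M := X) (N := C)) φ
  have hfx : f x = 0 := LinearMap.congr_fun (LinearMap.mem_ker.1 hxker) f
  have h0 : s • φ (LocalizedModule.mkLinearMap p.asIdeal.primeCompl X x) = 0 := by
    have := LinearMap.congr_fun hf (LocalizedModule.mkLinearMap p.asIdeal.primeCompl X x)
    simp only [LinearMap.smul_apply] at this
    rw [this]
    simp [LocalizedModule.mkLinearMap_apply, LocalizedModule.map_mk, hfx]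
  exact hφ (IsLocalizedModule.smul_injective
    (LocalizedModule.mkLinearMap p.asIdeal.primeCompl C) s (by simpa using h0))

/-- Evaluating at generators of `Hom(X, C)` gives a map `X → Cⁿ` with surjective `C`-dual. -/
lemma exists_linearMap_pi_dual_surjective (hC : IsSemidualizing R C)
    (X : Type u) [AddCommGroup X] [Module R X] [Module.Finite R X] :
    ∃ (n : ℕ) (f : X →ₗ[R] Fin n → C),
      ∀ φ : X →ₗ[R] C, ∃ ψ : (Fin n → C) →ₗ[R] C, ψ ∘ₗ f = φ := by
  have := hC.finite
  have : Module.Finite R (X →ₗ[R] C) := inferInstance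
  obtain ⟨n, s, hs⟩ := Module.Finite.exists_fin (R := R) (M := X →ₗ[R] C)
  refine ⟨n, LinearMap.pi s, fun φ ↦ ?_⟩
  obtain ⟨a, ha⟩ := (Submodule.mem_span_range_iff_exists_fun R).1 (hs ▸ Submodule.mem_top (x := φ))
  refine ⟨∑ i, a i • LinearMap.proj i, ?_⟩
  rw [← ha]
  ext x
  simp

end Reflexive

/-! ### Reflexivity and dimension shifting -/

section Main

open Abelian

variable {R : Type u} [CommRing R] {C : Type u} [AddCommGroup C] [Module R C]
  [IsNoetherianRing R]

/-- If every module with vanishing `Ext^{>0}(-, C)` is `C`-torsionless, then such a module embeds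
in some `Cⁿ` with `C`-dual surjective and cokernel again of that kind. -/
lemma exists_pi_embedding (hC : IsSemidualizing R C)
    (H : ∀ (X : Type u) [AddCommGroup X] [Module R X] [Module.Finite R X],
      ExtPosVanish R X C → Function.Injective (bidualMap R C X))
    {X : Type u} [AddCommGroup X] [Module R X] [Module.Finite R X] (hX : ExtPosVanish R X C) :
    ∃ (n : ℕ) (f : X →ₗ[R] Fin n → C), Function.Injective f ∧
      (∀ φ : X →ₗ[R] C, ∃ ψ : (Fin n → C) →ₗ[R] C, ψ ∘ₗ f = φ) ∧
      ExtPosVanish R ((Fin n → C) ⧸ LinearMap.range f) C := by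
  obtain ⟨n, f, hf⟩ := exists_linearMap_pi_dual_surjective hC X
  have hinj : Function.Injective f := by
    refine fun x y hxy ↦ H X hX (LinearMap.ext fun φ ↦ ?_)
    obtain ⟨ψ, rfl⟩ := hf φ
    exact congrArg ψ hxy
  refine ⟨n, f, hinj, hf, ?_⟩
  rintro (_ | _ | i) hi
  · exact absurd hi (lt_irrefl _)
  · exact subsingleton_ext_one_quotient C hinj (Submodule.mkQ_surjective _)
      (LinearMap.exact_map_mkQ_range f) (hC.ext_self.pi n 1 hi) hf
  · exact subsingleton_ext_quotient C hinj (Submodule.mkQ_surjective _)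
      (LinearMap.exact_map_mkQ_range f) (hC.ext_self.pi n _ hi) (hX _ i.succ_pos)

lemma bidualMap_bijective (hC : IsSemidualizing R C)
    (H : ∀ (X : Type u) [AddCommGroup X] [Module R X] [Module.Finite R X],
      ExtPosVanish R X C → Function.Injective (bidualMap R C X))
    {X : Type u} [AddCommGroup X] [Module R X] [Module.Finite R X] (hX : ExtPosVanish R X C) :
    Function.Bijective (bidualMap R C X) := by
  refine ⟨H X hX, fun φ ↦ ?_⟩
  have := hC.finite
  obtain ⟨n, f, hinj, hf, hY⟩ := exists_pi_embedding hC H hX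
  obtain ⟨c, hc⟩ := bidualMap_pi_surjective hC n (φ ∘ₗ LinearMap.lcomp R C f)
  have hc' (ψ : (Fin n → C) →ₗ[R] C) : ψ c = φ (ψ ∘ₗ f) := LinearMap.congr_fun hc ψ
  -- A functional on the cokernel pulls back to one vanishing on `X`, so it kills the class of `c`;
  -- the cokernel is torsionless, hence that class is zero.
  have hcf : c ∈ LinearMap.range f := by
    rw [← Submodule.Quotient.mk_eq_zero]
    refine H _ hY (LinearMap.ext fun y ↦ ?_)
    have : (y ∘ₗ (LinearMap.range f).mkQ) ∘ₗ f = 0 := by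
      ext x
      simp [(Submodule.Quotient.mk_eq_zero _).2 (LinearMap.mem_range_self f x)]
    rw [map_zero]
    change y (Submodule.Quotient.mk c) = 0
    simpa [this] using hc' (y ∘ₗ (LinearMap.range f).mkQ)
  obtain ⟨x, rfl⟩ := hcf
  refine ⟨x, LinearMap.ext fun ψ ↦ ?_⟩
  obtain ⟨ψ, rfl⟩ := hf ψ
  exact hc' ψ

lemma extPosVanish_dual (hC : IsSemidualizing R C)
    (H : ∀ (X : Type u) [AddCommGroup X] [Module R X] [Module.Finite R X],
      ExtPosVanish R X C → Function.Injective (bidualMap R C X))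
    {X : Type u} [AddCommGroup X] [Module R X] [Module.Finite R X] (hX : ExtPosVanish R X C) :
    ExtPosVanish R (X →ₗ[R] C) C := by
  have := hC.finite
  rintro (_ | i) hi
  · exact absurd hi (lt_irrefl _)
  -- `X` must vary, since the inductive step replaces it by the cokernel.
  induction i generalizing X with
  | zero =>
    obtain ⟨n, f, hinj, hf, hY⟩ := exists_pi_embedding hC H hX
    have := projective_dual_pi hC n
    refine subsingleton_ext_one_quotient C (f := LinearMap.lcomp R C (LinearMap.range f).mkQ)
      (g := LinearMap.lcomp R C f) (dual_mkQ_injective f) hf (dual_mkQ_exact f)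
      (subsingleton_ext_of_projective C _ 0) fun φ ↦ ?_
    -- A functional on `Y†` is evaluation at some `y`; evaluation at a lift of `y` to `Cⁿ` extends
    -- it to `(Cⁿ)†`.
    obtain ⟨y, rfl⟩ := (bidualMap_bijective hC H hY).2 φ
    obtain ⟨c, rfl⟩ := Submodule.mkQ_surjective _ y
    exact ⟨bidualMap R C _ c, rfl⟩
  | succ i ih =>
    obtain ⟨n, f, hinj, hf, hY⟩ := exists_pi_embedding hC H hX
    have := projective_dual_pi hC n
    exact subsingleton_ext_quotient C (f := LinearMap.lcomp R C (LinearMap.range f).mkQ)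
      (g := LinearMap.lcomp R C f) (dual_mkQ_injective f) hf (dual_mkQ_exact f)
      (subsingleton_ext_of_projective C _ (i + 1)) (ih hY i.succ_pos)

end Main

theorem theorem4p3 (R : Type u) [CommRing R] [IsNoetherianRing R]
    (C : Type u) [AddCommGroup C] [Module R C] (hC : IsSemidualizing R C)
    (d : ℕ) (hd : 0 < d) (hsup : (⨆ p : PrimeSpectrum R, ringDepthAt R p) = (d : ℕ∞))
    (hS : SerreS R R d) (hG : ConditionG R C 0) (hES : ConditionES R C 1)
    (M : Type u) [AddCommGroup M] [Module R M] [Module.Finite R M]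
    (hM : ExtPosVanish R M C) :
    IsTotallyReflexive R C M := by
  have H (X : Type u) [AddCommGroup X] [Module R X] [Module.Finite R X]
      (hX : ExtPosVanish R X C) : Function.Injective (bidualMap R C X) :=
    bidualMap_injective hC hd hS hG hES hX
  exact ⟨bidualMap_bijective hC H hM, hM, extPosVanish_dual hC H hM⟩
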